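/- All Hilbert spaces are finite-dimensional, and $\log$ is to base $2$. For a Hilbert space $\mathcal H$ let $\mathcal P(\mathcal H)$ be the set of positive semi-definite operators, $\mathcal S_{=}(\mathcal H)=\{\rho\in\mathcal P(\mathcal H):\operatorname{tr}\rho=1\}$ and $\mathcal S_{\le}(\mathcal H)=\{\rho\in\mathcal P(\mathcal H):0<\operatorname{tr}\rho\le 1\}$. For $\rho,\tau\in\mathcal P(\mathcal H)$ let $F(\rho,\tau)=\|\sqrt\rho\sqrt\tau\|_1$. For $\rho,\tau\in\mathcal S_{\le}(\mathcal H)$ let $$\bar F(\rho,\tau)=\sup_{\bar{\mathcal H}\supseteq\mathcal H}\ \sup_{\bar\rho,\bar\tau}F(\bar\rho,\bar\tau),$$ where $\mathcal H$ is isometrically embedded in $\bar{\mathcal H}$ with projector $\Pi$ and $\bar\rho,\bar\tau\in\mathcal S_{=}(\bar{\mathcal H})$ satisfy $\rho=\Pi\bar\rho\,\Pi$, $\tau=\Pi\bar\tau\,\Pi$; let $P(\rho,\tau)=\sqrt{1-\bar F(\rho,\tau)^2}$ be the purified distance. For $0\le\varepsilon<\sqrt{\operatorname{tr}\rho}$ let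 $\mathcal B^\varepsilon(\rho)=\{\tilde\rho\in\mathcal S_{\le}(\mathcal H):P(\tilde\rho,\rho)\le\varepsilon\}$. For $\rho_{AB}\in\mathcal S_{\le}(\mathcal H_A\otimes\mathcal H_B)$ define $$H_{\min}(A|B)_\rho=\sup_{\sigma_B\in\mathcal S_{=}(\mathcal H_B)}\sup\{\lambda\in\mathbb R:2^{-\lambda}\,1_A\otimes\sigma_B\ge\rho_{AB}\},\qquad H^\varepsilon_{\min}(A|B)_\rho=\sup_{\tilde\rho_{AB}\in\mathcal B^\varepsilon(\rho_{AB})}H_{\min}(A|B)_{\tilde\rho},$$ and $H^\varepsilon_{\max}(A|B)_\rho=-H^\varepsilon_{\min}(A|E)_\rho$, where $\rho_{ABE}=|\psi\rangle\langle\psi|$ is an arbitrary purification of $\rho_{AB}$ (the value does not depend on which one). **Theorem 2.** Let $\rho_{ABC}\in\mathcal S_{\le}(\mathcal H_A\otimes\mathcal H_B\otimes\mathcal H_C)$ and $0\le\varepsilon<\sqrt{\operatorname{tr}\rho_{ABC}}$. Let $\{|i\rangle_A\}_i$ and $\{|i\rangle_X\}_i$ be orthonormal bases, with the same index set, of $\mathcal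 H_A$ and of $\mathcal H_X\cong\mathcal H_A$, let $\mathcal M(\omega)=\sum_i\langle i|\omega|i\rangle\,|i\rangle\langle i|_X$ be the corresponding projective measurement, and let $\tau_{XBC}=(\mathcal M\otimes\mathrm{id}_{BC})(\rho_{ABC})$. Then $$H^\varepsilon_{\min}(AB|C)_\rho\le H^\varepsilon_{\min}(XB|C)_\tau\qquad\text{and}\qquad H^\varepsilon_{\max}(AB|C)_\rho\le H^\varepsilon_{\max}(XB|C)_\tau,$$ where the second inequality holds whichever purifications of $\rho_{ABC}$ and $\tau_{XBC}$ are used in the definition of $H^\varepsilon_{\max}$. -/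

import Mathlib

open scoped MatrixOrder ComplexOrder Matrix Kronecker

noncomputable section

namespace SmoothEntropy

/-! A finite-dimensional Hilbert space is `ℂ^n` for a finite index type `n`, an operator on it is a
matrix over `n`, the tensor product of `ℂ^a` and `ℂ^b` is `ℂ^(a × b)`, and an operator inequality
`A ≤ B` means that `B - A` is positive semi-definite. -/

/-- Sub-normalized states: positive semi-definite with trace in `(0, 1]`. -/
def IsSubnormalized {n : Type*} [Fintype n] (ρ : Matrix n n ℂ) : Prop :=
  ρ.PosSemidef ∧ 0 < ρ.trace.re ∧ ρ.trace.re ≤ 1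

/-- Normalized states: positive semi-definite with trace one. -/
def IsNormalized {n : Type*} [Fintype n] (ρ : Matrix n n ℂ) : Prop :=
  ρ.PosSemidef ∧ ρ.trace = 1

/-- The Schatten 1-norm, the trace of the square root of `Xᴴ X`. -/
def traceNorm {n : Type*} [Fintype n] [DecidableEq n] (X : Matrix n n ℂ) : ℝ :=
  (CFC.sqrt (Xᴴ * X)).trace.re

/-- The fidelity `‖√ρ √τ‖₁`. -/
def fidelity {n : Type*} [Fintype n] [DecidableEq n] (ρ τ : Matrix n n ℂ) : ℝ :=
  traceNorm (CFC.sqrt ρ * CFC.sqrt τ)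

/-- The generalized fidelity of two sub-normalized states: the supremum of the fidelities of
normalized states `ρ'`, `τ'` on a larger space whose compressions to `ℂ^n` are `ρ` and `τ`.
The embedding of `ℂ^n` into the larger space is the isometry `V`. -/
def genFidelity {n : Type*} [Fintype n] [DecidableEq n] (ρ τ : Matrix n n ℂ) : ℝ :=
  sSup {f : ℝ | ∃ (d : ℕ) (V : Matrix (Fin d) n ℂ) (ρ' τ' : Matrix (Fin d) (Fin d) ℂ),
    Vᴴ * V = 1 ∧ IsNormalized ρ' ∧ IsNormalized τ' ∧
    Vᴴ * ρ' * V = ρ ∧ Vᴴ * τ' * V = τ ∧ f = fidelity ρ' τ'}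

/-- The purified distance. -/
def purifiedDist {n : Type*} [Fintype n] [DecidableEq n] (ρ τ : Matrix n n ℂ) : ℝ :=
  Real.sqrt (1 - genFidelity ρ τ ^ 2)

/-- The closed ball of sub-normalized states around `ρ` for the purified distance. -/
def epsBall {n : Type*} [Fintype n] [DecidableEq n] (ε : ℝ) (ρ : Matrix n n ℂ) :
    Set (Matrix n n ℂ) :=
  {τ | IsSubnormalized τ ∧ purifiedDist τ ρ ≤ ε}

/-- The min-entropy of the first factor conditioned on the second one. The supremum is taken in the
extended reals, so that a `σ` without any admissible `l` contributes `-∞`. -/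
def minEntropy {a b : Type*} [Fintype a] [DecidableEq a] [Fintype b] [DecidableEq b]
    (ρ : Matrix (a × b) (a × b) ℂ) : EReal :=
  ⨆ σ ∈ {σ : Matrix b b ℂ | IsNormalized σ},
    sSup {h : EReal | ∃ l : ℝ,
      ρ ≤ ((2 : ℝ) ^ (-l)) • ((1 : Matrix a a ℂ) ⊗ₖ σ) ∧ h = (l : EReal)}

/-- The smooth min-entropy: the largest min-entropy in the `ε`-ball. -/
def smoothMinEntropy {a b : Type*} [Fintype a] [DecidableEq a] [Fintype b] [DecidableEq b]
    (ε : ℝ) (ρ : Matrix (a × b) (a × b) ℂ) : EReal :=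
  ⨆ ρ' ∈ epsBall ε ρ, minEntropy ρ'

/-- The rank-one operator `|ψ⟩⟨ψ|`. -/
def pureState {n : Type*} (ψ : n → ℂ) : Matrix n n ℂ :=
  Matrix.vecMulVec ψ (star ψ)

/-- Partial trace over the last factor. -/
def traceRight {h k : Type*} [Fintype k] (ω : Matrix (h × k) (h × k) ℂ) : Matrix h h ℂ :=
  Matrix.of fun i j => ∑ r, ω (i, r) (j, r)

/-- Partial trace over the middle factor `b` of `a ⊗ b ⊗ e`. -/
def traceMiddle {a b e : Type*} [Fintype b] (ω : Matrix ((a × b) × e) ((a × b) × e) ℂ) :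
    Matrix (a × e) (a × e) ℂ :=
  Matrix.of fun p q => ∑ r, ω ((p.1, r), p.2) ((q.1, r), q.2)

/-- `ψ` is a purification of `ρ`, with purifying space `ℂ^e`. -/
def IsPurification {h e : Type*} [Fintype e] (ψ : h × e → ℂ) (ρ : Matrix h h ℂ) : Prop :=
  traceRight (pureState ψ) = ρ

/-- Every positive semi-definite operator has a purification. -/
theorem exists_isPurification {h : Type*} [Fintype h] [DecidableEq h] (ρ : Matrix h h ℂ)
    (hρ : ρ.PosSemidef) : ∃ ψ : h × h → ℂ, IsPurification ψ ρ := by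
  refine ⟨fun p => CFC.sqrt ρ p.1 p.2, ?_⟩
  have hs : (CFC.sqrt ρ)ᴴ = CFC.sqrt ρ :=
    (Matrix.nonneg_iff_posSemidef.mp (CFC.sqrt_nonneg ρ)).isHermitian
  have hm : CFC.sqrt ρ * (CFC.sqrt ρ)ᴴ = ρ := by
    rw [hs]; exact CFC.sqrt_mul_sqrt_self ρ hρ.nonneg
  ext i j
  rw [← congrFun (congrFun hm i) j]
  simp [traceRight, pureState, Matrix.vecMulVec_apply, Matrix.mul_apply]

/-- The smooth max-entropy of `a` conditioned on `b` of a state on `a ⊗ b` with purification `ψ` on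
`a ⊗ b ⊗ e`: minus the smooth min-entropy of `a` conditioned on `e` of the marginal of `ψ` on
`a ⊗ e`. -/
def smoothMaxEntropy {a b e : Type*} [Fintype a] [DecidableEq a] [Fintype b]
    [Fintype e] [DecidableEq e] (ε : ℝ) (ψ : (a × b) × e → ℂ) : EReal :=
  -smoothMinEntropy ε (traceMiddle (pureState ψ))

/-- The projective measurement in the orthonormal basis `u`, with outcomes recorded in the
orthonormal basis `v`: the map sending `ρ` to `∑ i, ⟨u i| ρ |u i⟩ |v i⟩⟨v i|`. -/
def measurement {a x κ : Type*} [Fintype a] [Fintype x] [Fintype κ]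
    (u : OrthonormalBasis κ ℂ (EuclideanSpace ℂ a))
    (v : OrthonormalBasis κ ℂ (EuclideanSpace ℂ x)) :
    Matrix a a ℂ →ₗ[ℂ] Matrix x x ℂ where
  toFun ρ := ∑ i, (star (u i).ofLp ⬝ᵥ (ρ *ᵥ (u i).ofLp)) • pureState (v i).ofLp
  map_add' ρ τ := by
    simp [Matrix.add_mulVec, dotProduct_add, add_smul, Finset.sum_add_distrib]
  map_smul' c ρ := by
    simp [Matrix.smul_mulVec, dotProduct_smul, mul_smul, Finset.smul_sum]

/-- The map `M ⊗ id` on operators on `a ⊗ b ⊗ c`, where `M` acts on the first factor. -/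
def applyFirst {a x b c : Type*} (M : Matrix a a ℂ →ₗ[ℂ] Matrix x x ℂ)
    (ρ : Matrix ((a × b) × c) ((a × b) × c) ℂ) : Matrix ((x × b) × c) ((x × b) × c) ℂ :=
  Matrix.of fun p q =>
    M (Matrix.of fun i j => ρ ((i, p.1.2), p.2) ((j, q.1.2), q.2)) p.1.1 q.1.1

end SmoothEntropy

end

set_option linter.unusedSectionVars false

noncomputable section

namespace SmoothEntropy

open Matrix

/-! ### Contractions, the trace norm and Uhlmann's theorem -/

section Contractions

variable {m n p q : Type*} [Fintype m] [Fintype n] [Fintype p] [Fintype q]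

/-! Both inequalities follow from one principle, `smoothMinEntropy_le_krausMap`: a trace
non-increasing completely positive map that sends each `1 ⊗ σ` below some `1 ⊗ σ'` cannot lower the
smooth min-entropy, provided the image of the centre still has root trace above `ε`. Such a map
preserves the operator inequality defining the min-entropy, and it sends `ε`-balls to `ε`-balls
because the generalized fidelity is monotone (`genFidelity_le_krausMap`), which rests on Uhlmann's
theorem.

For the min-entropy, apply this to the measurement itself: it is trace preserving and unital, so `1
⊗ σ` goes to `1 ⊗ σ`.

For the max-entropy, take purifications `ψ` of `ρ` and `φ` of `τ`, and Kraus operators `B i` of the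
measurement. The measurement can be undone with help from the purifying system: `L = ∑ i, (B i)ᴴ ⊗ S
i` maps `φ` to `ψ`, where `∑ i, (S i)ᴴ * S i ≤ 1`. As `(B i)ᴴ * B j = 0` for `i ≠ j`, the cross
terms of `L (1 ⊗ σ) Lᴴ` vanish, leaving `∑ i, (B i)ᴴ B i ⊗ S i σ (S i)ᴴ`, which is below `1 ⊗ ∑ i, S
i σ (S i)ᴴ`. The principle applied to `L` compares the min-entropies given the purifying systems;
negation finishes. -/

theorem conj_mono {A B : Matrix n n ℂ} (h : A ≤ B) (K : Matrix m n ℂ) :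
    K * A * Kᴴ ≤ K * B * Kᴴ := by
  rw [Matrix.le_iff] at h ⊢
  simpa [Matrix.mul_sub, Matrix.sub_mul] using h.mul_mul_conjTranspose_same K

theorem re_trace_mono {A B : Matrix n n ℂ} (h : A ≤ B) : A.trace.re ≤ B.trace.re := by
  have := (Matrix.le_iff.mp h).trace_nonneg
  rw [trace_sub] at this
  have := (Complex.le_def.mp this).1
  simpa using this

/-- Follows from `1 - K Kᴴ = K (1 - Kᴴ K) Kᴴ + (1 - K Kᴴ)²`, a sum of positive terms. -/
theorem mul_conjTranspose_le_one [DecidableEq m] [DecidableEq n] {K : Matrix m n ℂ}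
    (h : Kᴴ * K ≤ 1) : K * Kᴴ ≤ 1 := by
  have h1 := conj_mono h K
  have h2 : (0 : Matrix m m ℂ) ≤ (1 - K * Kᴴ) * (1 - K * Kᴴ)ᴴ :=
    (posSemidef_self_mul_conjTranspose _).nonneg
  rw [← sub_nonneg] at h1 ⊢
  convert add_nonneg h1 h2 using 1
  simp only [conjTranspose_sub, conjTranspose_one, conjTranspose_mul, conjTranspose_conjTranspose]
  simp only [Matrix.mul_sub, Matrix.sub_mul, Matrix.mul_one, Matrix.one_mul, Matrix.mul_assoc]
  abel

theorem IsHermitian.le_one_of_mul_self [DecidableEq n] {A : Matrix n n ℂ} (hA : A.IsHermitian)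
    (h : A * A = A) : A ≤ 1 := by
  have h2 : (0 : Matrix n n ℂ) ≤ (1 - A) * (1 - A)ᴴ :=
    (posSemidef_self_mul_conjTranspose _).nonneg
  rw [← sub_nonneg]
  convert h2 using 1
  simp only [conjTranspose_sub, conjTranspose_one, hA.eq]
  rw [Matrix.mul_sub, Matrix.sub_mul, Matrix.sub_mul, h]
  simp

/-- A Hermitian matrix has a Hermitian generalized inverse. -/
theorem exists_pseudoInverse [DecidableEq n] {A : Matrix n n ℂ} (hA : A.IsHermitian) :
    ∃ B : Matrix n n ℂ, B.IsHermitian ∧ A * B * A = A ∧ B * A * B = B := by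
  have hsa : IsSelfAdjoint A := hA
  have hfin : (spectrum ℝ A).Finite := Matrix.finite_real_spectrum
  -- Finiteness of the spectrum makes inversion continuous on it even if it contains `0`; the
  -- convention `0⁻¹ = 0` then yields the generalized inverse.
  have hc : ContinuousOn (fun x : ℝ => x⁻¹) (spectrum ℝ A) := hfin.continuousOn _
  have hid : ContinuousOn (fun x : ℝ => x) (spectrum ℝ A) := continuousOn_id
  have hA' : cfc (fun x : ℝ => x) A = A := cfc_id' ℝ A
  refine ⟨cfc (fun x : ℝ => x⁻¹) A, cfc_predicate (R := ℝ) _ A, ?_, ?_⟩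
  · conv_lhs => rw [← hA', hA', ← hA']
    conv_rhs => rw [← hA']
    nth_rw 2 [hA']
    rw [← cfc_mul _ _ A hid hc, ← cfc_mul (fun x : ℝ => x * x⁻¹) _ A (hid.mul hc) hid]
    simp
  · conv_lhs => rw [← hA', hA']
    nth_rw 2 [← hA']
    rw [← cfc_mul _ _ A hc hid, ← cfc_mul (fun x : ℝ => x⁻¹ * x) _ A (hc.mul hid) hc]
    refine congrArg (fun f : ℝ → ℝ => cfc f A) (funext fun x => ?_)
    rcases eq_or_ne x 0 with rfl | hx
    · simp
    · rw [inv_mul_cancel₀ hx, one_mul]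

/-- Two factors of the same positive semi-definite matrix differ by a contraction. -/
theorem exists_contraction_of_mul_conjTranspose_eq [DecidableEq m] [DecidableEq p] [DecidableEq q]
    {Φ : Matrix m p ℂ} {Ψ : Matrix m q ℂ} (h : Φ * Φᴴ = Ψ * Ψᴴ) :
    ∃ T : Matrix p q ℂ, Φ * T = Ψ ∧ T * Tᴴ ≤ 1 ∧ Tᴴ * T ≤ 1 := by
  obtain ⟨B, hB, h1, h2⟩ := exists_pseudoInverse (isHermitian_mul_conjTranspose_self Φ)
  have hT : (Φᴴ * B * Ψ) * (Φᴴ * B * Ψ)ᴴ ≤ 1 := by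
    have he : (Φᴴ * B * Ψ) * (Φᴴ * B * Ψ)ᴴ = Φᴴ * B * Φ := by
      simp only [conjTranspose_mul, conjTranspose_conjTranspose, hB.eq]
      calc Φᴴ * B * Ψ * (Ψᴴ * (B * Φ)) = Φᴴ * (B * (Ψ * Ψᴴ) * B) * Φ := by
            simp only [Matrix.mul_assoc]
        _ = _ := by rw [← h, h2]
    rw [he]
    refine IsHermitian.le_one_of_mul_self ?_ ?_
    · simp only [Matrix.IsHermitian, conjTranspose_mul, conjTranspose_conjTranspose, hB.eq,
        Matrix.mul_assoc]
    · calc Φᴴ * B * Φ * (Φᴴ * B * Φ) = Φᴴ * (B * (Φ * Φᴴ) * B) * Φ := by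
            simp only [Matrix.mul_assoc]
        _ = _ := by rw [h2]
  refine ⟨Φᴴ * B * Ψ, ?_, hT, ?_⟩
  -- `Φ Φᴴ B - 1` annihilates `Φ Φᴴ = Ψ Ψᴴ`, hence also `Ψ`.
  · have h3 : (Φ * Φᴴ * B - 1) * Ψ = 0 := by
      rw [← mul_self_mul_conjTranspose_eq_zero, ← h, Matrix.sub_mul, h1, Matrix.one_mul, sub_self]
    rw [Matrix.sub_mul, sub_eq_zero, Matrix.one_mul] at h3
    conv_rhs => rw [← h3]
    simp only [Matrix.mul_assoc]
  · simpa using mul_conjTranspose_le_one (K := (Φᴴ * B * Ψ)ᴴ) (by simpa using hT)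


theorem isHermitian_sqrt [DecidableEq n] (A : Matrix n n ℂ) : (CFC.sqrt A).IsHermitian :=
  (Matrix.nonneg_iff_posSemidef.mp (CFC.sqrt_nonneg A)).isHermitian

theorem sqrt_mul_conjTranspose_sqrt [DecidableEq n] {A : Matrix n n ℂ} (hA : 0 ≤ A) :
    CFC.sqrt A * (CFC.sqrt A)ᴴ = A := by
  rw [(isHermitian_sqrt A).eq, CFC.sqrt_mul_sqrt_self A hA]

/-- The real part of a contraction is at most the identity. -/
theorem re_trace_mul_le_of_contraction [DecidableEq n] {P C : Matrix n n ℂ} (hP : 0 ≤ P)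
    (hC : C * Cᴴ ≤ 1) : (P * C).trace.re ≤ P.trace.re := by
  have hs := sqrt_mul_conjTranspose_sqrt hP
  have hsh := (isHermitian_sqrt P).eq
  set S := CFC.sqrt P
  have h1 : (0 : Matrix n n ℂ) ≤ (1 - C) * (1 - C)ᴴ := (posSemidef_self_mul_conjTranspose _).nonneg
  -- Expanding `(1 - C)(1 - C)ᴴ ≥ 0` gives `C + Cᴴ ≤ 1 + C Cᴴ`.
  have h2 : C + Cᴴ ≤ 1 + 1 := by
    rw [← sub_nonneg] at hC ⊢
    convert add_nonneg h1 hC using 1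
    simp only [conjTranspose_sub, conjTranspose_one, Matrix.mul_sub, Matrix.sub_mul,
      Matrix.mul_one, Matrix.one_mul]
    abel
  have h3 := re_trace_mono (conj_mono h2 S)
  have h4 : (S * Cᴴ * Sᴴ).trace = star (S * C * Sᴴ).trace := by
    rw [← trace_conjTranspose]
    simp [Matrix.mul_assoc]
  have h5 : (S * C * Sᴴ).trace = (P * C).trace := by
    rw [← hs, hsh, trace_mul_comm, Matrix.mul_assoc]
  rw [Matrix.mul_add, Matrix.add_mul, Matrix.mul_add, Matrix.add_mul, trace_add, trace_add, h4,
    Matrix.mul_one, hs, h5] at h3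
  simp at h3
  linarith

/-- Duality of the trace norm and contractions. -/
theorem re_trace_mul_le_traceNorm [DecidableEq n] {C : Matrix n n ℂ} (Y : Matrix n n ℂ)
    (hC : C * Cᴴ ≤ 1) : (C * Yᴴ).trace.re ≤ traceNorm Y := by
  have hY : (0 : Matrix n n ℂ) ≤ Yᴴ * Y := (posSemidef_conjTranspose_mul_self Y).nonneg
  -- A polar decomposition `Yᴴ = |Y| T` with `T` a contraction.
  obtain ⟨T, hT, hT1, -⟩ := exists_contraction_of_mul_conjTranspose_eq
    (Φ := CFC.sqrt (Yᴴ * Y)) (Ψ := Yᴴ) (by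
      rw [sqrt_mul_conjTranspose_sqrt hY, conjTranspose_conjTranspose])
  rw [← hT, trace_mul_comm, Matrix.mul_assoc]
  refine re_trace_mul_le_of_contraction (CFC.sqrt_nonneg _) ?_
  have := conj_mono hC T
  rw [Matrix.mul_one] at this
  simpa [Matrix.mul_assoc] using this.trans hT1

/-- The duality bound is attained by the contraction `W` with `Yᴴ W = |Y|`. -/
theorem exists_re_trace_mul_eq_traceNorm [DecidableEq n] (Y : Matrix n n ℂ) :
    ∃ W : Matrix n n ℂ, Wᴴ * W ≤ 1 ∧ W * Wᴴ ≤ 1 ∧ (W * Yᴴ).trace.re = traceNorm Y := by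
  have hY : (0 : Matrix n n ℂ) ≤ Yᴴ * Y := (posSemidef_conjTranspose_mul_self Y).nonneg
  obtain ⟨T, hT, hT1, hT2⟩ := exists_contraction_of_mul_conjTranspose_eq
    (Ψ := CFC.sqrt (Yᴴ * Y)) (Φ := Yᴴ) (by
      rw [sqrt_mul_conjTranspose_sqrt hY, conjTranspose_conjTranspose])
  exact ⟨T, hT2, hT1, by rw [trace_mul_comm, hT, traceNorm]⟩

/-- One half of Uhlmann's theorem. -/
theorem re_trace_mul_conjTranspose_le_fidelity [DecidableEq n] [DecidableEq p]
    (R S : Matrix n p ℂ) :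
    (R * Sᴴ).trace.re ≤ fidelity (R * Rᴴ) (S * Sᴴ) := by
  have hR : (0 : Matrix n n ℂ) ≤ R * Rᴴ := (posSemidef_self_mul_conjTranspose R).nonneg
  have hS : (0 : Matrix n n ℂ) ≤ S * Sᴴ := (posSemidef_self_mul_conjTranspose S).nonneg
  obtain ⟨T, hT, hT1, hT2⟩ := exists_contraction_of_mul_conjTranspose_eq
    (sqrt_mul_conjTranspose_sqrt hR)
  obtain ⟨U, hU, hU1, hU2⟩ := exists_contraction_of_mul_conjTranspose_eq
    (sqrt_mul_conjTranspose_sqrt hS)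
  have h : (R * Sᴴ).trace =
      (T * Uᴴ * (CFC.sqrt (R * Rᴴ) * CFC.sqrt (S * Sᴴ))ᴴ).trace := by
    conv_lhs => rw [← hT, ← hU]
    simp only [conjTranspose_mul, (isHermitian_sqrt _).eq, Matrix.mul_assoc]
    rw [trace_mul_comm]
    simp only [Matrix.mul_assoc]
  rw [h]
  refine re_trace_mul_le_traceNorm _ ?_
  have := conj_mono hU2 T
  rw [Matrix.mul_one] at this
  simpa [Matrix.mul_assoc] using this.trans hT1

/-- The other half of Uhlmann's theorem. -/
theorem exists_fidelity_eq_re_trace [DecidableEq n] {ρ τ : Matrix n n ℂ}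
    (hρ : ρ.PosSemidef) (hτ : τ.PosSemidef) :
    ∃ R S : Matrix n (n ⊕ n) ℂ, R * Rᴴ = ρ ∧ S * Sᴴ = τ ∧
      (R * Sᴴ).trace.re = fidelity ρ τ := by
  obtain ⟨W, hW1, hW2, hW⟩ := exists_re_trace_mul_eq_traceNorm (CFC.sqrt ρ * CFC.sqrt τ)
  have hD := sqrt_mul_conjTranspose_sqrt (sub_nonneg.mpr hW1)
  have hρ' := sqrt_mul_conjTranspose_sqrt hρ.nonneg
  have hτ' := sqrt_mul_conjTranspose_sqrt hτ.nonneg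
  set D := CFC.sqrt (1 - Wᴴ * W)
  -- `W` need not be unitary. The block `√τ D` supplies what `√τ Wᴴ` lacks to be a factor of `τ`,
  -- and the zero block opposite it keeps the overlap unchanged.
  refine ⟨fromCols (CFC.sqrt ρ) 0, fromCols (CFC.sqrt τ * Wᴴ) (CFC.sqrt τ * D), ?_, ?_, ?_⟩
  · simp [conjTranspose_fromCols_eq_fromRows_conjTranspose, fromCols_mul_fromRows, hρ']
  · rw [conjTranspose_fromCols_eq_fromRows_conjTranspose, fromCols_mul_fromRows]
    calc _ = CFC.sqrt τ * (Wᴴ * W + D * Dᴴ) * (CFC.sqrt τ)ᴴ := by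
          simp only [conjTranspose_mul, conjTranspose_conjTranspose, Matrix.mul_add,
            Matrix.add_mul, Matrix.mul_assoc]
      _ = τ := by rw [hD]; simp [hτ']
  · rw [conjTranspose_fromCols_eq_fromRows_conjTranspose, fromCols_mul_fromRows, fidelity, ← hW]
    simp only [conjTranspose_mul, conjTranspose_conjTranspose, Matrix.zero_mul, add_zero,
      (isHermitian_sqrt _).eq]
    rw [trace_mul_comm, Matrix.mul_assoc]

end Contractions

/-! ### Monotonicity of the generalized fidelity and of the purified distance -/

section GenFidelity

variable {ι m n k N : Type*} [Fintype ι] [Fintype m] [Fintype n] [Fintype k] [Fintype N]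

/-- The completely positive map with Kraus operators `K i`. -/
def krausMap (K : ι → Matrix m n ℂ) (ω : Matrix n n ℂ) : Matrix m m ℂ :=
  ∑ i, K i * ω * (K i)ᴴ

/-- The operators `K i * R`, side by side. -/
def krausStack (K : ι → Matrix m n ℂ) (R : Matrix n k ℂ) : Matrix m (ι × k) ℂ :=
  Matrix.of fun p q => (K q.1 * R) p q.2

theorem krausStack_mul_conjTranspose (K : ι → Matrix m n ℂ) (R S : Matrix n k ℂ) :
    krausStack K R * (krausStack K S)ᴴ = krausMap K (R * Sᴴ) := by
  ext p q
  have h : ∀ i, K i * (R * Sᴴ) * (K i)ᴴ = (K i * R) * (K i * S)ᴴ := fun i => by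
    simp only [conjTranspose_mul, Matrix.mul_assoc]
  simp only [krausMap, h, Matrix.sum_apply]
  simp only [krausStack, mul_apply (M := Matrix.of _), conjTranspose_apply, of_apply,
    Fintype.sum_prod_type]
  simp only [Matrix.mul_apply, conjTranspose_apply]

theorem krausMap_posSemidef (K : ι → Matrix m n ℂ) {ω : Matrix n n ℂ} (hω : ω.PosSemidef) :
    (krausMap K ω).PosSemidef :=
  posSemidef_sum _ fun i _ => hω.mul_mul_conjTranspose_same (K i)

theorem krausMap_mono (K : ι → Matrix m n ℂ) {A B : Matrix n n ℂ} (h : A ≤ B) :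
    krausMap K A ≤ krausMap K B :=
  Finset.sum_le_sum fun i _ => conj_mono h (K i)

theorem trace_krausMap (K : ι → Matrix m n ℂ) (ω : Matrix n n ℂ) :
    (krausMap K ω).trace = (ω * ∑ i, (K i)ᴴ * K i).trace := by
  simp only [krausMap, trace_sum, Matrix.mul_sum]
  refine Finset.sum_congr rfl fun i _ => ?_
  rw [Matrix.mul_assoc, trace_mul_comm, Matrix.mul_assoc]

theorem trace_krausMap_le [DecidableEq n] {K : ι → Matrix m n ℂ} (hK : ∑ i, (K i)ᴴ * K i ≤ 1)
    {ω : Matrix n n ℂ} (hω : ω.PosSemidef) : (krausMap K ω).trace.re ≤ ω.trace.re := by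
  have hs := sqrt_mul_conjTranspose_sqrt hω.nonneg
  have h := re_trace_mono (conj_mono hK (CFC.sqrt ω)ᴴ)
  rw [trace_krausMap]
  rw [trace_mul_comm, ← Matrix.mul_assoc, conjTranspose_conjTranspose, hs, Matrix.mul_one,
    trace_mul_comm _ (CFC.sqrt ω), hs] at h
  exact h

/-- Here `ρ` is supported on the complement of the range of `V`, so only the weight `1 - tr (Vᴴ τ
V)` of `τ` there contributes to the fidelity. -/
theorem fidelity_le_of_isNormalized [DecidableEq n] {ρ τ : Matrix n n ℂ} (V : Matrix n m ℂ)
    [DecidableEq m] (hV : Vᴴ * V = 1) (hρ : IsNormalized ρ) (hτ : IsNormalized τ)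
    (h0 : Vᴴ * ρ * V = 0) :
    fidelity ρ τ ^ 2 ≤ 1 - (Vᴴ * τ * V).trace.re := by
  obtain ⟨R, S, hR, hS, hF⟩ := exists_fidelity_eq_re_trace hρ.1 hτ.1
  set Q : Matrix n n ℂ := 1 - V * Vᴴ with hQ
  have hQh : Qᴴ = Q := by simp [hQ]
  have hQQ : Q * Q = Q := by
    have : V * Vᴴ * (V * Vᴴ) = V * Vᴴ := by
      rw [Matrix.mul_assoc, ← Matrix.mul_assoc Vᴴ, hV, Matrix.one_mul]
    simp [hQ, Matrix.mul_sub, Matrix.sub_mul, this]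
  have hVR : Vᴴ * R = 0 := by
    rw [← self_mul_conjTranspose_eq_zero, ← h0, ← hR]
    simp [Matrix.mul_assoc]
  have hQR : Q * R = R := by
    simp [hQ, Matrix.sub_mul, Matrix.mul_assoc, hVR]
  have hRQ : Rᴴ * Q = Rᴴ := by
    rw [← hQh, ← conjTranspose_mul, hQR]
  set t : ℝ := fidelity ρ τ
  -- With `t` the fidelity, the trace of this square is `t² - 2t·t + (1 - tr (Vᴴ τ V))`.
  have key : (0 : Matrix n n ℂ) ≤ ((t : ℂ) • R - Q * S) * ((t : ℂ) • R - Q * S)ᴴ :=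
    (posSemidef_self_mul_conjTranspose _).nonneg
  have h1 := re_trace_mono key
  have e1 : (R * (Sᴴ * Q)).trace = (R * Sᴴ).trace := by
    rw [← Matrix.mul_assoc, trace_mul_comm, ← Matrix.mul_assoc, hQR]
  have e2 : (Q * S * Rᴴ).trace = star (R * Sᴴ).trace := by
    rw [← trace_conjTranspose, Matrix.mul_assoc, trace_mul_comm, Matrix.mul_assoc, hRQ]
    simp
  have e3 : (Q * S * (Sᴴ * Q)).trace = 1 - (Vᴴ * τ * V).trace := by
    rw [Matrix.mul_assoc, ← Matrix.mul_assoc S, hS, trace_mul_comm, Matrix.mul_assoc, hQQ, hQ,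
      Matrix.mul_sub, trace_sub, Matrix.mul_one, hτ.2, ← Matrix.mul_assoc, trace_mul_comm,
      Matrix.mul_assoc]
  have e4 : (R * Rᴴ).trace = 1 := by rw [hR, hρ.2]
  simp only [conjTranspose_sub, conjTranspose_smul, conjTranspose_mul, hQh, Matrix.mul_sub,
    Matrix.sub_mul, Matrix.smul_mul, Matrix.mul_smul, trace_sub, trace_smul, e1, e2, e3, e4] at h1
  simp [hF] at h1
  nlinarith

theorem fidelity_le_one [DecidableEq n] {ρ τ : Matrix n n ℂ}
    (hρ : IsNormalized ρ) (hτ : IsNormalized τ) : fidelity ρ τ ≤ 1 := by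
  -- A zero-dimensional `V` makes the compression hypothesis vacuous.
  have h := fidelity_le_of_isNormalized (0 : Matrix n (Fin 0) ℂ) (Subsingleton.elim _ _) hρ hτ
    (Subsingleton.elim _ _)
  simp at h
  nlinarith [abs_le.mp h]

theorem fidelity_nonneg [DecidableEq n] (ρ τ : Matrix n n ℂ) : 0 ≤ fidelity ρ τ := by
  have := (Matrix.nonneg_iff_posSemidef.mp (CFC.sqrt_nonneg
    ((CFC.sqrt ρ * CFC.sqrt τ)ᴴ * (CFC.sqrt ρ * CFC.sqrt τ)))).trace_nonneg
  exact (Complex.le_def.mp this).1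

theorem genFidelity_nonneg [DecidableEq n] (ρ τ : Matrix n n ℂ) : 0 ≤ genFidelity ρ τ := by
  refine Real.sSup_nonneg ?_
  rintro _ ⟨d, V, ρ', τ', -, -, -, -, -, rfl⟩
  exact fidelity_nonneg _ _

/-- Any finite index type may carry the extensions, not only `Fin d`, and by Uhlmann any pair of
factors bounds the fidelity from below. -/
theorem re_trace_le_genFidelity [DecidableEq n] [DecidableEq N] [DecidableEq k]
    {V : Matrix N n ℂ} (hV : Vᴴ * V = 1)
    {R S : Matrix N k ℂ} (hR : (R * Rᴴ).trace = 1) (hS : (S * Sᴴ).trace = 1)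
    {ρ τ : Matrix n n ℂ} (hρ : Vᴴ * (R * Rᴴ) * V = ρ) (hτ : Vᴴ * (S * Sᴴ) * V = τ) :
    (R * Sᴴ).trace.re ≤ genFidelity ρ τ := by
  let e := (Fintype.equivFin N).symm
  have hmul : ∀ A B : Matrix N k ℂ, A.submatrix e id * (B.submatrix e id)ᴴ =
      (A * Bᴴ).submatrix e e := fun A B => by
    rw [conjTranspose_submatrix, ← submatrix_mul_equiv A Bᴴ e (Equiv.refl k) e]
    rfl
  have htr : ∀ A : Matrix N N ℂ, (A.submatrix e e).trace = A.trace := fun A => by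
    simpa [trace] using Equiv.sum_comp e fun i => A i i
  have hconj : ∀ A : Matrix N N ℂ, (V.submatrix e id)ᴴ * A.submatrix e e * V.submatrix e id =
      Vᴴ * A * V := fun A => by
    rw [conjTranspose_submatrix, submatrix_mul_equiv Vᴴ A id e e,
      submatrix_mul_equiv (Vᴴ * A) V id e id, submatrix_id_id]
  have hle := re_trace_mul_conjTranspose_le_fidelity (R.submatrix e id) (S.submatrix e id)
  rw [hmul, hmul, hmul, htr] at hle
  refine hle.trans (le_csSup ⟨1, ?_⟩ ?_)
  · rintro _ ⟨d, V, ρ', τ', -, h1, h2, -, -, rfl⟩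
    exact fidelity_le_one h1 h2
  · refine ⟨_, V.submatrix e id, _, _, ?_, ⟨?_, ?_⟩, ⟨?_, ?_⟩, ?_, ?_, rfl⟩
    · rw [conjTranspose_submatrix, submatrix_mul_equiv Vᴴ V id e id, hV, submatrix_id_id]
    · exact (posSemidef_self_mul_conjTranspose R).submatrix e
    · rw [htr, hR]
    · exact (posSemidef_self_mul_conjTranspose S).submatrix e
    · rw [htr, hS]
    · rw [hconj, hρ]
    · rw [hconj, hτ]

/-- The generalized fidelity does not decrease under trace non-increasing completely positive
maps. -/
theorem genFidelity_le_krausMap [DecidableEq n] [DecidableEq m] {K : ι → Matrix m n ℂ}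
    (hK : ∑ i, (K i)ᴴ * K i ≤ 1) (ρ τ : Matrix n n ℂ) :
    genFidelity ρ τ ≤ genFidelity (krausMap K ρ) (krausMap K τ) := by
  classical
  refine Real.sSup_le ?_ (genFidelity_nonneg _ _)
  rintro _ ⟨d, V, ρ', τ', hV, hρ', hτ', rfl, rfl, rfl⟩
  obtain ⟨R, S, hR, hS, hF⟩ := exists_fidelity_eq_re_trace hρ'.1 hτ'.1
  have hG : V * (∑ i, (K i)ᴴ * K i) * Vᴴ ≤ 1 := by
    have h1 := conj_mono hK V
    rw [Matrix.mul_one] at h1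
    exact h1.trans (mul_conjTranspose_le_one hV.le)
  have hL := sqrt_mul_conjTranspose_sqrt (sub_nonneg.mpr hG)
  set L := CFC.sqrt (1 - V * (∑ i, (K i)ᴴ * K i) * Vᴴ) with hLdef
  have hLh : Lᴴ = L := (isHermitian_sqrt _).eq
  -- Completion to a trace preserving map: the missing weight goes through `L` into an extra block,
  -- which compression to `m` discards.
  let K' : Option ι → Matrix (m ⊕ Fin d) (Fin d) ℂ := fun o =>
    o.elim (fromRows 0 L) fun i => fromRows (K i * Vᴴ) 0
  have hK' : ∑ o, (K' o)ᴴ * K' o = 1 := by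
    rw [Fintype.sum_option]
    simp only [K', Option.elim, conjTranspose_fromRows_eq_fromCols_conjTranspose,
      fromCols_mul_fromRows, conjTranspose_zero, Matrix.zero_mul, zero_add, add_zero,
      conjTranspose_mul, conjTranspose_conjTranspose]
    rw [hLh]
    nth_rw 2 [← hLh]
    rw [hL]
    have : ∀ i, V * (K i)ᴴ * (K i * Vᴴ) = V * ((K i)ᴴ * K i) * Vᴴ := fun i => by
      simp only [Matrix.mul_assoc]
    simp only [this, ← Matrix.sum_mul, ← Matrix.mul_sum, sub_add_cancel]
  have htr : ∀ ω : Matrix (Fin d) (Fin d) ℂ, (krausMap K' ω).trace = ω.trace := fun ω => by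
    rw [trace_krausMap, hK', Matrix.mul_one]
  have hcomp : ∀ ω : Matrix (Fin d) (Fin d) ℂ,
      (fromRows (1 : Matrix m m ℂ) (0 : Matrix (Fin d) m ℂ))ᴴ * krausMap K' ω *
        fromRows (1 : Matrix m m ℂ) (0 : Matrix (Fin d) m ℂ) = krausMap K (Vᴴ * ω * V) := by
    intro ω
    have h1 : (fromRows (1 : Matrix m m ℂ) (0 : Matrix (Fin d) m ℂ))ᴴ * K' none = 0 := by
      simp [K', conjTranspose_fromRows_eq_fromCols_conjTranspose, fromCols_mul_fromRows]
    have h2 : ∀ i, (fromRows (1 : Matrix m m ℂ) (0 : Matrix (Fin d) m ℂ))ᴴ * K' (some i) =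
        K i * Vᴴ := fun i => by
      simp [K', conjTranspose_fromRows_eq_fromCols_conjTranspose, fromCols_mul_fromRows]
    have h3 : ∀ o, (fromRows (1 : Matrix m m ℂ) (0 : Matrix (Fin d) m ℂ))ᴴ *
        (K' o * ω * (K' o)ᴴ) * fromRows (1 : Matrix m m ℂ) (0 : Matrix (Fin d) m ℂ) =
        ((fromRows (1 : Matrix m m ℂ) (0 : Matrix (Fin d) m ℂ))ᴴ * K' o) * ω *
        ((fromRows (1 : Matrix m m ℂ) (0 : Matrix (Fin d) m ℂ))ᴴ * K' o)ᴴ := fun o => by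
      simp only [conjTranspose_mul, conjTranspose_conjTranspose, Matrix.mul_assoc]
    rw [krausMap, Matrix.mul_sum, Matrix.sum_mul, Finset.sum_congr rfl fun o _ => h3 o,
      Fintype.sum_option, h1]
    simp only [h2, krausMap]
    simp [Matrix.mul_assoc]
  -- Stacking the Kraus operators dilates both factors and keeps their overlap, since `K'` preserves
  -- the trace.
  rw [← hF, ← htr, ← krausStack_mul_conjTranspose]
  refine re_trace_le_genFidelity
    (V := fromRows (1 : Matrix m m ℂ) (0 : Matrix (Fin d) m ℂ)) ?_ ?_ ?_ ?_ ?_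
  · simp [conjTranspose_fromRows_eq_fromCols_conjTranspose, fromCols_mul_fromRows]
  · rw [krausStack_mul_conjTranspose, htr, hR, hρ'.2]
  · rw [krausStack_mul_conjTranspose, htr, hS, hτ'.2]
  · rw [krausStack_mul_conjTranspose, hR, hcomp]
  · rw [krausStack_mul_conjTranspose, hS, hcomp]

theorem purifiedDist_krausMap_le [DecidableEq n] [DecidableEq m] {K : ι → Matrix m n ℂ}
    (hK : ∑ i, (K i)ᴴ * K i ≤ 1) (ρ τ : Matrix n n ℂ) :
    purifiedDist (krausMap K ρ) (krausMap K τ) ≤ purifiedDist ρ τ :=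
  Real.sqrt_le_sqrt (sub_le_sub_left
    (pow_le_pow_left₀ (genFidelity_nonneg _ _) (genFidelity_le_krausMap hK ρ τ) 2) 1)

/-- This keeps `0` out of `ε`-balls, so that images of ball elements have positive trace. -/
theorem sqrt_trace_le_purifiedDist_zero [DecidableEq n] {ρ : Matrix n n ℂ}
    (hρ : ρ.trace.re ≤ 1) : √ρ.trace.re ≤ purifiedDist 0 ρ := by
  have h : genFidelity 0 ρ ≤ √(1 - ρ.trace.re) := by
    refine Real.sSup_le ?_ (Real.sqrt_nonneg _)
    rintro _ ⟨d, V, ρ', τ', hV, hρ', hτ', h0, rfl, rfl⟩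
    exact Real.le_sqrt_of_sq_le (fidelity_le_of_isNormalized V hV hρ' hτ' h0)
  have h2 := pow_le_pow_left₀ (genFidelity_nonneg _ _) h 2
  rw [Real.sq_sqrt (by linarith)] at h2
  exact Real.sqrt_le_sqrt (by linarith)

/-- Trace non-increasing completely positive maps send `ε`-balls to `ε`-balls. -/
theorem krausMap_mem_epsBall [DecidableEq n] [DecidableEq m] {K : ι → Matrix m n ℂ}
    (hK : ∑ i, (K i)ᴴ * K i ≤ 1) {ε : ℝ} {ρ ω : Matrix n n ℂ} (hω : ω ∈ epsBall ε ρ)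
    (h1 : (krausMap K ρ).trace.re ≤ 1) (hε : ε < √(krausMap K ρ).trace.re) :
    krausMap K ω ∈ epsBall ε (krausMap K ρ) := by
  obtain ⟨⟨hpos, -, hle⟩, hd⟩ := hω
  have hd' := (purifiedDist_krausMap_le hK ω ρ).trans hd
  have hp := krausMap_posSemidef K hpos
  refine ⟨⟨hp, ?_, (trace_krausMap_le hK hpos).trans hle⟩, hd'⟩
  obtain ⟨hre, him⟩ := Complex.le_def.mp hp.trace_nonneg
  -- Zero trace would force the image to be `0`, which is at distance more than `ε` from the centre.
  refine lt_of_le_of_ne hre fun h0 => ?_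
  have h0 : krausMap K ω = 0 := hp.trace_eq_zero_iff.mp (Complex.ext h0.symm him.symm)
  rw [h0] at hd'
  exact absurd (hd'.trans_lt hε) (sqrt_trace_le_purifiedDist_zero h1).not_gt

end GenFidelity

/-! ### The monotonicity principle for the smooth min-entropy -/

section Entropy

variable {a b a' b' ι : Type*} [Fintype a] [DecidableEq a] [Fintype b] [DecidableEq b]
  [Fintype a'] [DecidableEq a'] [Fintype b'] [DecidableEq b'] [Fintype ι]

/-- A trace non-increasing completely positive map that sends each `1 ⊗ σ` below some `1 ⊗ σ'`
does not decrease the smooth min-entropy. -/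
theorem smoothMinEntropy_le_krausMap {K : ι → Matrix (a' × b') (a × b) ℂ}
    (hK : ∑ i, (K i)ᴴ * K i ≤ 1) {ε : ℝ} {ρ : Matrix (a × b) (a × b) ℂ}
    (h1 : (krausMap K ρ).trace.re ≤ 1) (hε : ε < √(krausMap K ρ).trace.re)
    (hσ : ∀ σ : Matrix b b ℂ, IsNormalized σ → ∃ σ' : Matrix b' b' ℂ, IsNormalized σ' ∧
      krausMap K ((1 : Matrix a a ℂ) ⊗ₖ σ) ≤ (1 : Matrix a' a' ℂ) ⊗ₖ σ') :
    smoothMinEntropy ε ρ ≤ smoothMinEntropy ε (krausMap K ρ) := by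
  refine iSup₂_le fun ω hω =>
    le_iSup₂_of_le (krausMap K ω) (krausMap_mem_epsBall hK hω h1 hε) ?_
  refine iSup₂_le fun σ hσn => sSup_le ?_
  rintro _ ⟨l, hl, rfl⟩
  obtain ⟨σ', hσ', hle⟩ := hσ σ hσn
  refine le_iSup₂_of_le σ' hσ' (le_sSup ⟨l, ?_, rfl⟩)
  refine (krausMap_mono K hl).trans ?_
  have hsmul : krausMap K (((2 : ℝ) ^ (-l)) • ((1 : Matrix a a ℂ) ⊗ₖ σ)) =
      ((2 : ℝ) ^ (-l)) • krausMap K ((1 : Matrix a a ℂ) ⊗ₖ σ) := by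
    simp only [krausMap, Matrix.mul_smul, Matrix.smul_mul, Finset.smul_sum]
  rw [hsmul]
  rw [Matrix.le_iff, ← smul_sub]
  exact (Matrix.le_iff.mp hle).smul (by positivity)

/-- A positive semi-definite operator of trace at most one is below some normalized state. -/
theorem exists_isNormalized_ge [Nonempty b] {σ : Matrix b b ℂ} (hσ : σ.PosSemidef)
    (h : σ.trace.re ≤ 1) : ∃ σ' : Matrix b b ℂ, IsNormalized σ' ∧ σ ≤ σ' := by
  obtain ⟨j⟩ := ‹Nonempty b›
  have h0 : (0 : ℂ) ≤ 1 - σ.trace := by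
    obtain ⟨-, him⟩ := Complex.le_def.mp hσ.trace_nonneg
    refine Complex.le_def.mpr ⟨by simpa using h, ?_⟩
    simpa using him.symm
  have hp : ((1 - σ.trace) • pureState (Pi.single j (1 : ℂ))).PosSemidef :=
    (posSemidef_vecMulVec_self_star _).smul h0
  refine ⟨σ + (1 - σ.trace) • pureState (Pi.single j 1), ⟨hσ.add hp, ?_⟩, ?_⟩
  · simp [pureState, trace_vecMulVec]
  · exact le_add_of_nonneg_right hp.nonneg

theorem kronecker_mono_right {P : Matrix a a ℂ} (hP : P.PosSemidef) {A B : Matrix b b ℂ}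
    (h : A ≤ B) : P ⊗ₖ A ≤ P ⊗ₖ B := by
  rw [Matrix.le_iff] at h ⊢
  have h2 : P ⊗ₖ B - P ⊗ₖ A = P ⊗ₖ (B - A) := by
    ext i j
    simp [mul_sub]
  rw [h2]
  exact hP.kronecker h

theorem sum_kronecker {l m n p : Type*} (A : ι → Matrix l m ℂ) (B : Matrix n p ℂ) :
    ∑ i, A i ⊗ₖ B = (∑ i, A i) ⊗ₖ B := by
  ext i j
  simp [Matrix.sum_apply, Finset.sum_mul]

end Entropy

/-! ### Channels on the first factor and their reversal on purifications -/

section Measurement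

variable {y z c κ e e' : Type*} [Fintype y] [DecidableEq y] [Fintype z] [DecidableEq z]
  [Fintype c] [DecidableEq c] [Fintype κ] [Fintype e] [DecidableEq e] [Fintype e'] [DecidableEq e']

theorem conjTranspose_kronecker_one (A : Matrix y z ℂ) :
    (A ⊗ₖ (1 : Matrix c c ℂ))ᴴ = Aᴴ ⊗ₖ (1 : Matrix c c ℂ) := by
  rw [conjTranspose_kronecker, conjTranspose_one]

theorem sum_conjTranspose_mul_kronecker_one {B : κ → Matrix y z ℂ}
    (hB : ∑ i, (B i)ᴴ * B i = 1) :
    ∑ i, (B i ⊗ₖ (1 : Matrix c c ℂ))ᴴ * (B i ⊗ₖ (1 : Matrix c c ℂ)) = 1 := by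
  simp only [conjTranspose_kronecker_one, ← mul_kronecker_mul, Matrix.one_mul]
  rw [sum_kronecker, hB, one_kronecker_one]

/-- Unital channels on the first factor do not decrease the smooth min-entropy. -/
theorem smoothMinEntropy_le_of_unital {B : κ → Matrix y z ℂ}
    (hB : ∑ i, (B i)ᴴ * B i = 1) (hB' : ∑ i, B i * (B i)ᴴ = 1) {ε : ℝ}
    {ρ : Matrix (z × c) (z × c) ℂ} (hρ : IsSubnormalized ρ) (hε : ε < √ρ.trace.re) :
    smoothMinEntropy ε ρ ≤
      smoothMinEntropy ε (krausMap (fun i => B i ⊗ₖ (1 : Matrix c c ℂ)) ρ) := by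
  have hK := sum_conjTranspose_mul_kronecker_one (c := c) hB
  have htr : (krausMap (fun i => B i ⊗ₖ (1 : Matrix c c ℂ)) ρ).trace = ρ.trace := by
    rw [trace_krausMap, hK, Matrix.mul_one]
  refine smoothMinEntropy_le_krausMap hK.le (by rw [htr]; exact hρ.2.2) (by rwa [htr])
    fun σ hσ => ⟨σ, hσ, ?_⟩
  simp only [krausMap, conjTranspose_kronecker_one, ← mul_kronecker_mul, Matrix.one_mul,
    Matrix.mul_one]
  rw [sum_kronecker, hB']

/-- Reading `ψ` as a matrix turns a purification into a factor of its marginal, so the contraction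
lemma applies. -/
theorem traceRight_pureState {h k : Type*} [Fintype k] (ψ : h × k → ℂ) :
    traceRight (pureState ψ) = (Matrix.of fun p q => ψ (p, q)) *
      (Matrix.of fun p q => ψ (p, q))ᴴ := by
  ext i j
  simp [traceRight, pureState, vecMulVec_apply, Matrix.mul_apply]

theorem traceMiddle_pureState (ψ : (z × c) × e → ℂ) :
    traceMiddle (pureState ψ) =
      (Matrix.of fun (p : z × e) (r : c) => ψ ((p.1, r), p.2)) *
      (Matrix.of fun (p : z × e) (r : c) => ψ ((p.1, r), p.2))ᴴ := by
  ext i j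
  simp [traceMiddle, pureState, vecMulVec_apply, Matrix.mul_apply]

theorem trace_traceMiddle (ω : Matrix ((z × c) × e) ((z × c) × e) ℂ) :
    (traceMiddle ω).trace = (traceRight ω).trace := by
  simp only [trace, diag_apply, traceMiddle, traceRight, of_apply, Fintype.sum_prod_type]
  exact Finset.sum_congr rfl fun _ _ => Finset.sum_comm

/-- The isometry that coherently measures with `B` may be undone on the purifying system: if `φ`
purifies the measured state and `ψ` the original one, a contraction of the form
`∑ i, (B i)ᴴ ⊗ S i` maps `φ` to `ψ`. -/
theorem exists_contractions_of_isPurification {B : κ → Matrix y z ℂ}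
    (hB : ∑ i, (B i)ᴴ * B i = 1) {ρ : Matrix (z × c) (z × c) ℂ}
    {ψ : (z × c) × e → ℂ} {φ : (y × c) × e' → ℂ} (hψ : IsPurification ψ ρ)
    (hφ : IsPurification φ (krausMap (fun i => B i ⊗ₖ (1 : Matrix c c ℂ)) ρ)) :
    ∃ S : κ → Matrix e e' ℂ, ∑ i, (S i)ᴴ * S i ≤ 1 ∧
      (∑ i, (B i)ᴴ ⊗ₖ S i) * (Matrix.of fun (p : y × e') (r : c) => φ ((p.1, r), p.2)) =
        Matrix.of fun (p : z × e) (r : c) => ψ ((p.1, r), p.2) := by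
  classical
  rw [IsPurification, traceRight_pureState] at hψ hφ
  rw [← hψ, ← krausStack_mul_conjTranspose] at hφ
  obtain ⟨T, hT, hT1, -⟩ := exists_contraction_of_mul_conjTranspose_eq hφ
  -- `T` multiplies on the right, along the purifying index; as an operator on that system its
  -- `i`-th block acts by the transpose.
  refine ⟨fun i => Matrix.of fun r s => T s (i, r), ?_, ?_⟩
  · have h : ∑ i, (Matrix.of fun r s => T s (i, r))ᴴ * (Matrix.of fun r s => T s (i, r)) =
        (T * Tᴴ)ᵀ := by
      ext p q
      simp [Matrix.sum_apply, Matrix.mul_apply, Fintype.sum_prod_type, mul_comm]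
    rw [h, Matrix.le_iff, ← transpose_one, ← transpose_sub]
    exact (Matrix.le_iff.mp hT1).transpose
  · have hslice : ∀ (r : c) (i : κ),
        (Matrix.of fun (p : y) q => φ ((p, r), q)) * (Matrix.of fun s t => T s (i, t)) =
        B i * Matrix.of fun (p : z) q => ψ ((p, r), q) := fun r i => by
      ext p q
      have := congrFun (congrFun hT (p, r)) (i, q)
      simpa [krausStack, Matrix.mul_apply, Fintype.sum_prod_type, one_apply] using this
    ext ⟨p, q⟩ r
    have h1 : ∑ i, (B i)ᴴ * ((Matrix.of fun (p : y) q => φ ((p, r), q)) *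
        (Matrix.of fun s t => T s (i, t))) = Matrix.of fun (p : z) q => ψ ((p, r), q) := by
      simp only [hslice, ← Matrix.mul_assoc]
      rw [← Matrix.sum_mul, hB, Matrix.one_mul]
    have h2 := congrFun (congrFun h1 p) q
    simp only [of_apply] at h2 ⊢
    rw [← h2, Matrix.sum_mul]
    simp only [Matrix.sum_apply]
    refine Finset.sum_congr rfl fun i _ => ?_
    simp only [Matrix.mul_apply, Fintype.sum_prod_type, of_apply, kronecker_apply, Finset.mul_sum]
    refine Finset.sum_congr rfl fun s _ => Finset.sum_congr rfl fun t _ => ?_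
    ring

theorem sum_kronecker_conj {B : κ → Matrix y z ℂ}
    (horth : ∀ i j, i ≠ j → (B i)ᴴ * B j = 0) (S : κ → Matrix e e' ℂ) (σ : Matrix e' e' ℂ) :
    (∑ i, (B i)ᴴ ⊗ₖ S i) * ((1 : Matrix y y ℂ) ⊗ₖ σ) * (∑ i, (B i)ᴴ ⊗ₖ S i)ᴴ =
      ∑ i, ((B i)ᴴ * B i) ⊗ₖ (S i * σ * (S i)ᴴ) := by
  simp only [conjTranspose_sum, conjTranspose_kronecker, conjTranspose_conjTranspose,
    Matrix.sum_mul, Matrix.mul_sum, ← mul_kronecker_mul, Matrix.mul_one]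
  refine Finset.sum_congr rfl fun i _ => ?_
  rw [Finset.sum_eq_single i]
  · intro j _ hj
    simp [horth, hj]
  · simp

/-- The max-entropy half: purifications of the state before and after the measurement. -/
theorem smoothMinEntropy_traceMiddle_le {B : κ → Matrix y z ℂ}
    (hB : ∑ i, (B i)ᴴ * B i = 1) (horth : ∀ i j, i ≠ j → (B i)ᴴ * B j = 0)
    {ε : ℝ} (hε0 : 0 ≤ ε) {ρ : Matrix (z × c) (z × c) ℂ} (hρ : IsSubnormalized ρ)
    (hε : ε < √ρ.trace.re) {ψ : (z × c) × e → ℂ} {φ : (y × c) × e' → ℂ}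
    (hψ : IsPurification ψ ρ)
    (hφ : IsPurification φ (krausMap (fun i => B i ⊗ₖ (1 : Matrix c c ℂ)) ρ)) :
    smoothMinEntropy ε (traceMiddle (pureState φ)) ≤
      smoothMinEntropy ε (traceMiddle (pureState ψ)) := by
  obtain ⟨S, hS, hSφ⟩ := exists_contractions_of_isPurification hB hψ hφ
  have htr : (traceMiddle (pureState ψ)).trace = ρ.trace := by
    rw [trace_traceMiddle, hψ]
  -- An empty purifying index would give `ρ` trace zero, against `0 ≤ ε < √(tr ρ)`. Nonemptiness
  -- lets the subnormalized `∑ i, S i σ (S i)ᴴ` be raised to a normalized state.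
  have hne : Nonempty e := by
    by_contra hne
    rw [not_nonempty_iff] at hne
    have : ρ.trace = 0 := by rw [← htr]; simp [trace]
    rw [this] at hε
    simp at hε
    linarith
  set L : Matrix (z × e) (y × e') ℂ := ∑ i, (B i)ᴴ ⊗ₖ S i with hL
  have himage : krausMap (fun _ : Unit => L) (traceMiddle (pureState φ)) =
      traceMiddle (pureState ψ) := by
    rw [traceMiddle_pureState, traceMiddle_pureState, ← hSφ]
    simp [krausMap, Matrix.mul_assoc]
  have hP : ∀ i, ((B i)ᴴ * B i).PosSemidef := fun i => posSemidef_conjTranspose_mul_self _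
  have hsum : ∀ (X : κ → Matrix e e ℂ) (Y : Matrix e e ℂ), (∀ i, X i ≤ Y) →
      ∑ i, ((B i)ᴴ * B i) ⊗ₖ X i ≤ (1 : Matrix z z ℂ) ⊗ₖ Y := fun X Y h => by
    rw [← hB, ← sum_kronecker]
    exact Finset.sum_le_sum fun i _ => kronecker_mono_right (hP i) (h i)
  have hSi : ∀ i, S i * (S i)ᴴ ≤ 1 := fun i => by
    refine mul_conjTranspose_le_one (le_trans ?_ hS)
    exact Finset.single_le_sum (f := fun i => (S i)ᴴ * S i)
      (fun j _ => (posSemidef_conjTranspose_mul_self (S j)).nonneg) (Finset.mem_univ i)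
  -- Orthogonality controls `L Lᴴ` (the case `σ = 1`), and the bound on `Lᴴ L` follows from it.
  have hLL : L * Lᴴ ≤ 1 := by
    have h := sum_kronecker_conj horth S 1
    rw [one_kronecker_one, Matrix.mul_one] at h
    rw [hL, h, ← one_kronecker_one]
    exact hsum _ _ fun i => by simpa using hSi i
  have hLL' : ∑ _i : Unit, Lᴴ * L ≤ 1 := by
    simpa using mul_conjTranspose_le_one (K := Lᴴ) (by simpa using hLL)
  rw [← himage]
  refine smoothMinEntropy_le_krausMap hLL' ?_ ?_ fun σ hσ => ?_
  · rw [himage, htr]; exact hρ.2.2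
  · rwa [himage, htr]
  · obtain ⟨σ', hσ', hle⟩ := exists_isNormalized_ge (krausMap_posSemidef S hσ.1)
      ((trace_krausMap_le hS hσ.1).trans (by simp [hσ.2]))
    refine ⟨σ', hσ', ?_⟩
    have h := sum_kronecker_conj horth S σ
    rw [← hL] at h
    simp only [krausMap, Finset.univ_unique, Finset.sum_singleton, h]
    refine hsum _ _ fun i => le_trans ?_ hle
    exact Finset.single_le_sum (f := fun i => S i * σ * (S i)ᴴ)
      (fun j _ => (hσ.1.mul_mul_conjTranspose_same (S j)).nonneg) (Finset.mem_univ i)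

end Measurement

/-! ### Kraus operators of the projective measurement -/

section ProjectiveMeasurement

variable {a b c x κ : Type*} [Fintype a] [DecidableEq a] [Fintype b] [DecidableEq b]
  [Fintype c] [DecidableEq c] [Fintype x] [DecidableEq x] [Fintype κ]

theorem sum_pureState_eq_one (u : OrthonormalBasis κ ℂ (EuclideanSpace ℂ a)) :
    ∑ i, pureState (u i).ofLp = 1 := by
  ext p q
  have h := congrArg (fun w : EuclideanSpace ℂ a => w p)
    (u.sum_repr' (EuclideanSpace.single q (1 : ℂ)))
  simp only [EuclideanSpace.inner_single_right, one_mul, WithLp.ofLp_sum, WithLp.ofLp_smul,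
    Finset.sum_apply, Pi.smul_apply, smul_eq_mul, PiLp.single_apply] at h
  simp only [Matrix.sum_apply, pureState, vecMulVec_apply, one_apply, Pi.star_apply]
  exact (Finset.sum_congr rfl fun i _ => mul_comm _ _).trans h

theorem star_dotProduct_orthonormalBasis [DecidableEq κ]
    (u : OrthonormalBasis κ ℂ (EuclideanSpace ℂ a)) (i j : κ) :
    star (u i).ofLp ⬝ᵥ (u j).ofLp = if i = j then 1 else 0 := by
  rw [← orthonormal_iff_ite.mp u.orthonormal i j, EuclideanSpace.inner_eq_star_dotProduct,
    dotProduct_comm]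

/-- The Kraus operators of the measurement, acting on the first of two factors. -/
def measurementKraus (b : Type*) [DecidableEq b] (u : OrthonormalBasis κ ℂ (EuclideanSpace ℂ a))
    (v : OrthonormalBasis κ ℂ (EuclideanSpace ℂ x)) (i : κ) : Matrix (x × b) (a × b) ℂ :=
  vecMulVec (v i).ofLp (star (u i).ofLp) ⊗ₖ (1 : Matrix b b ℂ)

theorem conjTranspose_measurementKraus_mul [DecidableEq κ]
    (u : OrthonormalBasis κ ℂ (EuclideanSpace ℂ a))
    (v : OrthonormalBasis κ ℂ (EuclideanSpace ℂ x)) (i j : κ) :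
    (measurementKraus b u v i)ᴴ * measurementKraus b u v j =
      if i = j then pureState (u i).ofLp ⊗ₖ (1 : Matrix b b ℂ) else 0 := by
  rw [measurementKraus, measurementKraus, conjTranspose_kronecker_one, ← mul_kronecker_mul,
    conjTranspose_vecMulVec, vecMulVec_mul_vecMulVec, star_dotProduct_orthonormalBasis]
  split_ifs with h
  · subst h; simp [pureState]
  · simp

theorem measurementKraus_mul_conjTranspose (u : OrthonormalBasis κ ℂ (EuclideanSpace ℂ a))
    (v : OrthonormalBasis κ ℂ (EuclideanSpace ℂ x)) (i : κ) :
    measurementKraus b u v i * (measurementKraus b u v i)ᴴ =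
      pureState (v i).ofLp ⊗ₖ (1 : Matrix b b ℂ) := by
  classical
  rw [measurementKraus, conjTranspose_kronecker_one, ← mul_kronecker_mul,
    conjTranspose_vecMulVec, vecMulVec_mul_vecMulVec]
  simp [star_dotProduct_orthonormalBasis, pureState]

theorem applyFirst_measurement (u : OrthonormalBasis κ ℂ (EuclideanSpace ℂ a))
    (v : OrthonormalBasis κ ℂ (EuclideanSpace ℂ x))
    (ρ : Matrix ((a × b) × c) ((a × b) × c) ℂ) :
    applyFirst (measurement u v) ρ =
      krausMap (fun i => measurementKraus b u v i ⊗ₖ (1 : Matrix c c ℂ)) ρ := by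
  ext ⟨⟨p, r⟩, s⟩ ⟨⟨q, r'⟩, s'⟩
  simp only [applyFirst, measurement, LinearMap.coe_mk, AddHom.coe_mk, of_apply, krausMap,
    Matrix.sum_apply]
  refine Finset.sum_congr rfl fun i _ => ?_
  simp [Matrix.mul_apply, measurementKraus, Fintype.sum_prod_type, one_apply, vecMulVec_apply,
    pureState, dotProduct, mulVec, Finset.sum_mul, Finset.mul_sum,
    apply_ite (starRingEnd ℂ)]
  rw [Finset.sum_comm]
  refine Finset.sum_congr rfl fun j _ => Finset.sum_congr rfl fun k _ => ?_
  ring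

end ProjectiveMeasurement

end SmoothEntropy

end

theorem theorem2 {a b c x κ e e' : Type*}
    [Fintype a] [DecidableEq a] [Fintype b] [DecidableEq b] [Fintype c] [DecidableEq c]
    [Fintype x] [DecidableEq x] [Fintype κ]
    [Fintype e] [DecidableEq e] [Fintype e'] [DecidableEq e']
    (ε : ℝ) (hε : 0 ≤ ε)
    (ρ : Matrix ((a × b) × c) ((a × b) × c) ℂ) (hρ : SmoothEntropy.IsSubnormalized ρ)
    (hερ : ε < Real.sqrt ρ.trace.re)
    (u : OrthonormalBasis κ ℂ (EuclideanSpace ℂ a))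
    (v : OrthonormalBasis κ ℂ (EuclideanSpace ℂ x))
    (τ : Matrix ((x × b) × c) ((x × b) × c) ℂ)
    (hτ : τ = SmoothEntropy.applyFirst (SmoothEntropy.measurement u v) ρ) :
    SmoothEntropy.smoothMinEntropy ε ρ ≤ SmoothEntropy.smoothMinEntropy ε τ ∧
    ∀ (ψ : ((a × b) × c) × e → ℂ) (φ : ((x × b) × c) × e' → ℂ),
      SmoothEntropy.IsPurification ψ ρ → SmoothEntropy.IsPurification φ τ →
      SmoothEntropy.smoothMaxEntropy ε ψ ≤ SmoothEntropy.smoothMaxEntropy ε φ := by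
  classical
  rw [SmoothEntropy.applyFirst_measurement] at hτ
  subst hτ
  have hB : ∑ i, (SmoothEntropy.measurementKraus b u v i)ᴴ *
      SmoothEntropy.measurementKraus b u v i = 1 := by
    simp only [SmoothEntropy.conjTranspose_measurementKraus_mul, if_true]
    rw [SmoothEntropy.sum_kronecker, SmoothEntropy.sum_pureState_eq_one, Matrix.one_kronecker_one]
  have hB' : ∑ i, SmoothEntropy.measurementKraus b u v i *
      (SmoothEntropy.measurementKraus b u v i)ᴴ = 1 := by
    simp only [SmoothEntropy.measurementKraus_mul_conjTranspose]
    rw [SmoothEntropy.sum_kronecker, SmoothEntropy.sum_pureState_eq_one, Matrix.one_kronecker_one]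
  refine ⟨SmoothEntropy.smoothMinEntropy_le_of_unital hB hB' hρ hερ, fun ψ φ hψ hφ => ?_⟩
  -- Negation reverses the order, so the purification of the measured state must have the smaller
  -- min-entropy.
  refine EReal.neg_le_neg_iff.mpr
    (SmoothEntropy.smoothMinEntropy_traceMiddle_le hB (fun i j hij => ?_) hε hρ hερ hψ hφ)
  rw [SmoothEntropy.conjTranspose_measurementKraus_mul, if_neg hij]
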